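/- Let $\mathcal H$ be a separable complex Hilbert space with orthonormal basis $(e_n)$, let $\mathcal T(\mathcal H)$ be its trace class operators and $S(\mathcal H)$ its states (positive operators of trace one), and let $X$ be a measurable space. A quantum random variable is a map $f:X\to\mathcal B(\mathcal H)$ such that $x\mapsto\operatorname{tr}(s f(x))$ is measurable for every $s\in S(\mathcal H)$. Let $\nu$ be a positive operator-valued measure on $X$ with values in $\mathcal B(\mathcal H)$, i.e. an ultraweakly countably additive map from the measurable sets to the positive operators. Let $\rho\in S(\mathcal H)$ be of full rank (injective), and let $\nu_\rho$ be the finite positive measure $\nu_\rho(E)=\operatorname{tr}(\rho\,\nu(E))$. Suppose that the Radon–Nikodým derivative $D=\frac{d\nu}{d\nu_\rho}$ exists, i.e. $D:X\to\mathcal B(\mathcal H)$ is a quantum random variable whose matrix entries $\langle D(\cdot)e_j,e_i\rangle$ are $\nu_\rho$-integrable with $\int_E\langle D(x)e_j,e_i\rangle\,d\nu_\rho(x)=\langle\nu(E)e_j,e_i\rangle$ for all $i,j$ and all measurable $E$ (then $D(x)\ge 0$ for $\nu_\rho$-almost every $x$). For a quantum random variable $f$ and $s\in S(\mathcal H)$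 put $f_s(x)=\operatorname{tr}\big(s\,D(x)^{1/2}f(x)D(x)^{1/2}\big)$. If $f\ge 0$, then $f$ is called $\nu$-integrable if $f_s$ is $\nu_\rho$-integrable for every $s\in S(\mathcal H)$; a general $f$ is $\nu$-integrable if the positive and negative parts of its real and imaginary parts are. For $\nu$-integrable $f$, the integral $\int_X f\,d\nu\in\mathcal B(\mathcal H)$ is defined by $\operatorname{tr}\big(s\int_X f\,d\nu\big)=\int_X f_s\,d\nu_\rho$ for all $s\in S(\mathcal H)$. Let $L^\infty_{\mathcal H}(X,\nu)\cong L^\infty(X,\nu_\rho)\,\overline\otimes\,\mathcal B(\mathcal H)$ be the space of $\nu$-essentially bounded quantum random variables modulo equality $\nu$-almost everywhere. Its predual is $L^1(X,\nu_\rho)\,\overline\otimes\,\mathcal T(\mathcal H)=L^1(X,\nu_\rho;\mathcal T(\mathcal H))$, that is, the quantum random variables $g$ with $\int_X\|g(x)\|_1\,d\nu_\rho(x)<\infty$ (modulo equality almost everywhere), with the pairing $\langle g,f\rangle=\int_X\operatorname{tr}(g(x)f(x))\,d\nu_\rho(x)$; the weak* topology of $L^\infty_{\mathcal H}(X,\nu)$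 is the coarsest one that makes all these pairings continuous. The weak* topology of $\mathcal B(\mathcal H)=\mathcal T(\mathcal H)^*$ is the ultraweak one, given by the functionals $A\mapsto\operatorname{tr}(tA)$, $t\in\mathcal T(\mathcal H)$. **Theorem.** Every $f\in L^\infty_{\mathcal H}(X,\nu)$ is $\nu$-integrable and has a unique integral $\mathbb E_\nu(f)=\int_X f\,d\nu\in\mathcal B(\mathcal H)$. For every $s\in\mathcal T(\mathcal H)$, the function $x\mapsto D(x)^{1/2}\,s\,D(x)^{1/2}$ belongs to the predual $L^1(X,\nu_\rho)\,\overline\otimes\,\mathcal T(\mathcal H)$. The quantum expected value map $\mathbb E_\nu:L^\infty_{\mathcal H}(X,\nu)\to\mathcal B(\mathcal H)$ is weak*–weak* continuous. -/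

import Mathlib

open MeasureTheory Filter Topology ComplexStarModule
open scoped ENNReal

noncomputable section

namespace QuantumExpectation

variable {H : Type*} [NormedAddCommGroup H] [InnerProductSpace ℂ H] [CompleteSpace H]
variable {ι : Type*} {X : Type*} [MeasurableSpace X]

/-! ### Trace class operators, states, the ultraweak topology -/

/-- The trace norm `‖T‖₁ = ∑ ⟨|T| eᵢ, eᵢ⟩ ∈ [0, ∞]`, where `|T| = (T* T)^{1/2}`.
It does not depend on the orthonormal basis. -/
def traceNorm (b : HilbertBasis ι ℂ H) (T : H →L[ℂ] H) : ℝ≥0∞ :=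
  ∑' i, ENNReal.ofReal (inner ℂ (b i) (CFC.abs T (b i))).re

/-- `T ∈ T(H)`: the operator `T` is of trace class. -/
def IsTraceClass (b : HilbertBasis ι ℂ H) (T : H →L[ℂ] H) : Prop :=
  traceNorm b T < ∞

/-- The trace `∑ ⟨T eᵢ, eᵢ⟩`, meant for trace class `T`, where the series converges absolutely and
does not depend on the orthonormal basis. (Mathlib's inner product is linear in the second
variable.) -/
def trace (b : HilbertBasis ι ℂ H) (T : H →L[ℂ] H) : ℂ :=
  ∑' i, inner ℂ (b i) (T (b i))

/-- The set `S(H)` of states (density operators): positive operators of unit trace. -/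
structure State (b : HilbertBasis ι ℂ H) where
  op : H →L[ℂ] H
  nonneg : 0 ≤ op
  isTraceClass : IsTraceClass b op
  trace_eq_one : trace b op = 1

/-- A state is full-rank if its kernel is trivial (equivalently, as it is self-adjoint, if its range
is dense). -/
def State.FullRank {b : HilbertBasis ι ℂ H} (ρ : State b) : Prop :=
  Function.Injective ρ.op

/-- The ultraweak (weak*) topology `σ(B(H), T(H))` on `B(H)`: the coarsest topology such that
`A ↦ tr(t A)` is continuous for every trace class operator `t`. -/
@[reducible] def ultraweak (b : HilbertBasis ι ℂ H) : TopologicalSpace (H →L[ℂ] H) :=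
  ⨅ t : {t : H →L[ℂ] H // IsTraceClass b t},
    TopologicalSpace.induced (fun A => trace b (t.1 * A)) inferInstance

/-! Helper facts on traces against positive trace class operators. -/

lemma inner_sqrt {P : H →L[ℂ] H} (hP : 0 ≤ P) (x y : H) :
    inner ℂ (CFC.sqrt P x) (CFC.sqrt P y) = inner ℂ x (P y) := by
  have h1 : IsSelfAdjoint (CFC.sqrt P) := IsSelfAdjoint.of_nonneg (CFC.sqrt_nonneg P)
  have h2 : CFC.sqrt P (CFC.sqrt P y) = P y := by
    rw [← mul_apply_eq_comp, CFC.sqrt_mul_sqrt_self P hP]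
  conv_rhs => rw [← h2]
  rw [← ContinuousLinearMap.adjoint_inner_left (CFC.sqrt P) (CFC.sqrt P y) x, h1.adjoint_eq]

lemma hasSum_norm_sq (b : HilbertBasis ι ℂ H) (x : H) :
    HasSum (fun i => ‖inner ℂ (b i) x‖ ^ 2) (‖x‖ ^ 2) := by
  have h := (Complex.hasSum_re (b.hasSum_inner_mul_inner x x))
  convert h using 1
  · ext i
    rw [← inner_conj_symm x (b i), mul_comm, RCLike.mul_conj]
    norm_cast
  · rw [inner_self_eq_norm_sq_to_K]
    norm_cast

lemma summable_sqrt {b : HilbertBasis ι ℂ H} {P : H →L[ℂ] H} (hP : 0 ≤ P)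
    (hT : IsTraceClass b P) : Summable fun i => ‖CFC.sqrt P (b i)‖ ^ 2 := by
  have h0 : ∀ i, (inner ℂ (b i) (P (b i))).re = ‖CFC.sqrt P (b i)‖ ^ 2 := by
    intro i
    rw [← inner_sqrt hP, inner_self_eq_norm_sq_to_K]
    norm_cast
  unfold IsTraceClass traceNorm at hT
  rw [CFC.abs_of_nonneg P hP] at hT
  simp only [h0] at hT
  have := ENNReal.summable_toReal hT.ne
  refine this.congr fun i => ?_
  rw [ENNReal.toReal_ofReal (by positivity)]

lemma summable_prod_norm_sq {b : HilbertBasis ι ℂ H} {S : H →L[ℂ] H}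
    (hS : Summable fun i => ‖S (b i)‖ ^ 2) :
    Summable fun p : ι × ι => ‖inner ℂ (b p.2) (S (b p.1))‖ ^ 2 := by
  rw [summable_prod_of_nonneg (fun p => sq_nonneg _)]
  refine ⟨fun i => (hasSum_norm_sq b (S (b i))).summable, hS.congr fun i => ?_⟩
  exact (hasSum_norm_sq b (S (b i))).tsum_eq.symm

lemma hasSum_trace_mul {b : HilbertBasis ι ℂ H} {P : H →L[ℂ] H} (hP : 0 ≤ P)
    (hT : IsTraceClass b P) (A : H →L[ℂ] H) :
    HasSum (fun i => inner ℂ (b i) ((P * A) (b i))) (trace b (P * A)) ∧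
    HasSum (fun i => inner ℂ (CFC.sqrt P (b i)) (A (CFC.sqrt P (b i)))) (trace b (P * A)) := by
  obtain ⟨R, hR⟩ : ∃ R, R = CFC.sqrt P := ⟨_, rfl⟩
  have hRs : IsSelfAdjoint R := hR ▸ IsSelfAdjoint.of_nonneg (CFC.sqrt_nonneg P)
  have hsw : ∀ x y, inner ℂ (R x) y = inner ℂ x (R y) := fun x y => by
    rw [← ContinuousLinearMap.adjoint_inner_left, hRs.adjoint_eq]
  have hs := summable_sqrt hP hT
  have hq : ∀ x y, inner ℂ (R x) (R y) = inner ℂ x (P y) := fun x y => by rw [hR, inner_sqrt hP]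
  rw [← hR] at hs ⊢
  clear hR
  let F : ι × ι → ℂ := fun p =>
    inner ℂ (R (b p.1)) (b p.2) * inner ℂ (b p.2) (R (A (b p.1)))
  have hF : Summable F := by
    obtain ⟨B, hB⟩ : ∃ B, B = ContinuousLinearMap.adjoint A := ⟨_, rfl⟩
    have h1 := summable_prod_norm_sq hs
    have h2 : Summable fun p : ι × ι => ‖inner ℂ (b p.2) ((B * R) (b p.1))‖ ^ 2 := by
      refine summable_prod_norm_sq (Summable.of_nonneg_of_le (fun i => sq_nonneg _) (fun i => ?_)
        (hs.mul_left (‖B‖ ^ 2)))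
      rw [← mul_pow]
      exact pow_le_pow_left₀ (norm_nonneg _) (B.le_opNorm _) 2
    have h3 := h1.add ((Equiv.prodComm ι ι).summable_iff.mpr h2)
    refine Summable.of_norm_bounded h3 fun p => ?_
    have e1 : ‖inner ℂ (R (b p.1)) (b p.2)‖ = ‖inner ℂ (b p.2) (R (b p.1))‖ :=
      norm_inner_symm _ _
    have e2 : ‖inner ℂ (b p.2) (R (A (b p.1)))‖ = ‖inner ℂ (b p.1) (B (R (b p.2)))‖ := by
      rw [← hsw, hB, ← ContinuousLinearMap.adjoint_inner_left, norm_inner_symm]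
    have e3 : ‖F p‖ = ‖inner ℂ (b p.2) (R (b p.1))‖ * ‖inner ℂ (b p.1) (B (R (b p.2)))‖ := by
      rw [norm_mul, e1, e2]
    have e4 : ∀ u v : ℝ, u * v ≤ u ^ 2 + v ^ 2 := fun u v => by
      nlinarith [sq_nonneg (u - v), sq_nonneg u, sq_nonneg v]
    rw [e3]
    exact e4 _ _
  have ha : ∀ i, HasSum (fun j => F (i, j)) (inner ℂ (b i) ((P * A) (b i))) := by
    intro i
    have := b.hasSum_inner_mul_inner (R (b i)) (R (A (b i)))
    rwa [hq] at this
  have hb : ∀ j, HasSum (fun i => F (i, j)) (inner ℂ (R (b j)) (A (R (b j)))) := by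
    intro j
    have := b.hasSum_inner_mul_inner ((ContinuousLinearMap.adjoint A) (R (b j))) (R (b j))
    rw [ContinuousLinearMap.adjoint_inner_left] at this
    have e : ∀ i, F (i, j) =
        inner ℂ ((ContinuousLinearMap.adjoint A) (R (b j))) (b i) * inner ℂ (b i) (R (b j)) := by
      intro i
      change inner ℂ (R (b i)) (b j) * inner ℂ (b j) (R (A (b i))) = _
      rw [hsw, ← hsw (b j), ← ContinuousLinearMap.adjoint_inner_left A (b i) (R (b j)), mul_comm]
    simpa only [e] using this
  have h1 := hF.hasSum.prod_fiberwise ha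
  have h2 := ((Equiv.prodComm ι ι).hasSum_iff.mpr hF.hasSum).prod_fiberwise hb
  have h3 : trace b (P * A) = ∑' p, F p := h1.tsum_eq
  rw [h3]
  exact ⟨h1, h2⟩

namespace State

variable {b : HilbertBasis ι ℂ H} (s : State b)

lemma trace_add (A B : H →L[ℂ] H) :
    trace b (s.op * (A + B)) = trace b (s.op * A) + trace b (s.op * B) := by
  have h := (hasSum_trace_mul s.nonneg s.isTraceClass A).1.add
    (hasSum_trace_mul s.nonneg s.isTraceClass B).1
  rw [← h.tsum_eq, trace]
  simp [mul_add]

lemma trace_smul (c : ℂ) (A : H →L[ℂ] H) :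
    trace b (s.op * (c • A)) = c * trace b (s.op * A) := by
  have h := (hasSum_trace_mul s.nonneg s.isTraceClass A).1.mul_left c
  rw [← h.tsum_eq, trace]
  simp

lemma trace_zero : trace b (s.op * 0) = 0 := by simp [trace]

lemma trace_sum {κ : Type*} (t : Finset κ) (A : κ → H →L[ℂ] H) :
    trace b (s.op * ∑ k ∈ t, A k) = ∑ k ∈ t, trace b (s.op * A k) := by
  classical
  induction t using Finset.induction_on with
  | empty => simpa using s.trace_zero
  | insert k t hk ih => rw [Finset.sum_insert hk, Finset.sum_insert hk, s.trace_add, ih]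

lemma trace_nonneg {A : H →L[ℂ] H} (hA : 0 ≤ A) :
    0 ≤ (trace b (s.op * A)).re ∧ (trace b (s.op * A)).im = 0 := by
  have h := (hasSum_trace_mul s.nonneg s.isTraceClass A).2
  have hp : ∀ x, 0 ≤ (inner ℂ x (A x)).re ∧ (inner ℂ x (A x)).im = 0 := by
    intro x
    rw [← inner_sqrt hA, inner_self_eq_norm_sq_to_K, RCLike.ofReal_eq_complex_ofReal,
      ← Complex.ofReal_pow]
    exact ⟨by rw [Complex.ofReal_re]; positivity, Complex.ofReal_im _⟩
  refine ⟨(Complex.hasSum_re h).nonneg fun i => (hp _).1, ?_⟩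
  have h2 := Complex.hasSum_im h
  simp only [(hp _).2] at h2
  exact h2.unique hasSum_zero

end State

/-- The pure state `ξ ↦ ⟨v, ξ⟩ v` given by a unit vector `v`. -/
def pureState (b : HilbertBasis ι ℂ H) (v : H) (hv : ‖v‖ = 1) : State b where
  op := InnerProductSpace.rankOne ℂ v v
  nonneg := by
    rw [ContinuousLinearMap.nonneg_iff_isPositive]
    exact InnerProductSpace.isPositive_rankOne_self v
  isTraceClass := by
    have h0 : (0 : H →L[ℂ] H) ≤ InnerProductSpace.rankOne ℂ v v := by
      rw [ContinuousLinearMap.nonneg_iff_isPositive]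
      exact InnerProductSpace.isPositive_rankOne_self v
    unfold IsTraceClass traceNorm
    rw [CFC.abs_of_nonneg _ h0]
    have h : ∀ i, (inner ℂ (b i) (InnerProductSpace.rankOne ℂ v v (b i))).re
        = ‖inner ℂ (b i) v‖ ^ 2 := by
      intro i
      rw [InnerProductSpace.rankOne_apply, inner_smul_right, ← inner_conj_symm v (b i), mul_comm,
        RCLike.mul_conj]
      norm_cast
    simp only [h]
    rw [← ENNReal.ofReal_tsum_of_nonneg (fun i => by positivity) (hasSum_norm_sq b v).summable]
    exact ENNReal.ofReal_lt_top
  trace_eq_one := by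
    have h := b.hasSum_inner_mul_inner v v
    rw [inner_self_eq_norm_sq_to_K, hv] at h
    rw [trace]
    convert h.tsum_eq using 1
    · congr 1
      ext i
      rw [InnerProductSpace.rankOne_apply, inner_smul_right]
    · simp

lemma trace_pureState (b : HilbertBasis ι ℂ H) (v : H) (hv : ‖v‖ = 1) (A : H →L[ℂ] H) :
    trace b ((pureState b v hv).op * A) = inner ℂ v (A v) := by
  have h := b.hasSum_inner_mul_inner (ContinuousLinearMap.adjoint A v) v
  rw [ContinuousLinearMap.adjoint_inner_left] at h
  rw [trace, ← h.tsum_eq]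
  congr 1
  ext i
  rw [mul_apply_eq_comp, pureState, InnerProductSpace.rankOne_apply, inner_smul_right,
    ContinuousLinearMap.adjoint_inner_left]

/-! ### Positive operator-valued measures -/

/-- A positive operator-valued measure on the measurable space `X` with values in `B(H)`: a map on
measurable sets (the values on other sets are irrelevant) that takes positive values and is
countably additive for the ultraweak topology. -/
structure POVM (X : Type*) [MeasurableSpace X] (b : HilbertBasis ι ℂ H) where
  toFun : Set X → (H →L[ℂ] H)
  nonneg : ∀ E, MeasurableSet E → 0 ≤ toFun E
  tendsto_iUnion : ∀ E : ℕ → Set X, (∀ k, MeasurableSet (E k)) →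
    Pairwise (Function.onFun Disjoint E) →
    Tendsto (fun n => ∑ k ∈ Finset.range n, toFun (E k)) atTop
      (@nhds _ (ultraweak b) (toFun (⋃ k, E k)))

namespace POVM

variable {b : HilbertBasis ι ℂ H} (ν : POVM X b)

lemma tendsto_trace (s : State b) (E : ℕ → Set X) (hE : ∀ k, MeasurableSet (E k))
    (hd : Pairwise (Function.onFun Disjoint E)) :
    Tendsto (fun n => ∑ k ∈ Finset.range n, trace b (s.op * ν.toFun (E k))) atTop
      (𝓝 (trace b (s.op * ν.toFun (⋃ k, E k)))) := by
  have hc : @Continuous _ _ (ultraweak b) _ (fun A => trace b (s.op * A)) :=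
    continuous_iInf_dom (i := ⟨s.op, s.isTraceClass⟩) continuous_induced_dom
  have h := (@Continuous.tendsto _ _ (ultraweak b) _ _ hc (ν.toFun (⋃ k, E k))).comp
    (ν.tendsto_iUnion E hE hd)
  refine h.congr fun n => ?_
  simp only [Function.comp, s.trace_sum]

lemma trace_empty (s : State b) : trace b (s.op * ν.toFun ∅) = 0 := by
  have h := ν.tendsto_trace s (fun _ => ∅) (fun _ => MeasurableSet.empty)
    (fun _ _ _ => by simp [Function.onFun])
  simp only [Set.iUnion_empty] at h
  have h' := (h.comp (tendsto_add_atTop_nat 1)).sub h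
  simp only [Function.comp, Finset.sum_range_succ, add_sub_cancel_left, sub_self] at h'
  exact tendsto_nhds_unique tendsto_const_nhds h'

lemma hasSum_trace_re (s : State b) (E : ℕ → Set X) (hE : ∀ k, MeasurableSet (E k))
    (hd : Pairwise (Function.onFun Disjoint E)) :
    HasSum (fun k => (trace b (s.op * ν.toFun (E k))).re)
      (trace b (s.op * ν.toFun (⋃ k, E k))).re := by
  rw [hasSum_iff_tendsto_nat_of_nonneg fun k => (s.trace_nonneg (ν.nonneg _ (hE k))).1]
  have h := (Complex.continuous_re.tendsto _).comp (ν.tendsto_trace s E hE hd)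
  refine h.congr fun n => ?_
  simp [Function.comp]

/-- The (finite positive) measure `ν_ρ(E) = tr(ρ ν(E))` induced by a POVM and a state. The trace is
a nonnegative real number, see `ofReal_inducedMeasure`. -/
def inducedMeasure (s : State b) : Measure X :=
  Measure.ofMeasurable (fun E _ => ENNReal.ofReal (trace b (s.op * ν.toFun E)).re)
    (by simp [ν.trace_empty s])
    (fun E hE hd => by
      have h := ν.hasSum_trace_re s E hE hd
      rw [← h.tsum_eq, ENNReal.ofReal_tsum_of_nonneg
        (fun k => (s.trace_nonneg (ν.nonneg _ (hE k))).1) h.summable])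

lemma inducedMeasure_apply (s : State b) {E : Set X} (hE : MeasurableSet E) :
    ν.inducedMeasure s E = ENNReal.ofReal (trace b (s.op * ν.toFun E)).re :=
  Measure.ofMeasurable_apply E hE

lemma ofReal_inducedMeasure (s : State b) {E : Set X} (hE : MeasurableSet E) :
    (((ν.inducedMeasure s E).toReal : ℝ) : ℂ) = trace b (s.op * ν.toFun E) := by
  have h := s.trace_nonneg (ν.nonneg E hE)
  rw [ν.inducedMeasure_apply s hE, ENNReal.toReal_ofReal h.1]
  exact Complex.ext (by simp) (by simp [h.2])

instance (s : State b) : IsFiniteMeasure (ν.inducedMeasure s) :=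
  ⟨by rw [ν.inducedMeasure_apply s MeasurableSet.univ]; exact ENNReal.ofReal_lt_top⟩

lemma eq_zero_iff {E : Set X} (hE : MeasurableSet E) :
    ν.toFun E = 0 ↔ ∀ s : State b, ν.inducedMeasure s E = 0 := by
  constructor
  · intro h s
    rw [ν.inducedMeasure_apply s hE, h, s.trace_zero]
    simp
  · intro h
    have h0 : ∀ s : State b, trace b (s.op * ν.toFun E) = 0 := fun s => by
      rw [← ν.ofReal_inducedMeasure s hE, h s]
      simp
    have hz : CFC.sqrt (ν.toFun E) = 0 := by
      ext x
      by_cases hx : x = 0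
      · simp [hx]
      have hn : ‖x‖ ≠ 0 := norm_ne_zero_iff.mpr hx
      have hv : ‖((‖x‖⁻¹ : ℝ) : ℂ) • x‖ = 1 := by
        rw [norm_smul]
        simp [hn]
      have h1 := h0 (pureState b _ hv)
      rw [trace_pureState, ← inner_sqrt (ν.nonneg E hE), inner_self_eq_zero, map_smul,
        smul_eq_zero] at h1
      rcases h1 with h1 | h1
      · simp [hn] at h1
      · simpa using h1
    rw [← CFC.sqrt_mul_sqrt_self (ν.toFun E) (ν.nonneg E hE), hz, mul_zero]

lemma union_eq_zero {E F : Set X} (hE : MeasurableSet E) (hF : MeasurableSet F)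
    (h1 : ν.toFun E = 0) (h2 : ν.toFun F = 0) : ν.toFun (E ∪ F) = 0 := by
  rw [ν.eq_zero_iff (hE.union hF)]
  intro s
  exact measure_union_null ((ν.eq_zero_iff hE).1 h1 s) ((ν.eq_zero_iff hF).1 h2 s)

/-- The filter of properties that hold `ν`-almost everywhere, i.e. outside a measurable set `E`
with `ν(E) = 0`. -/
def ae : Filter X where
  sets := {s | ∃ E, MeasurableSet E ∧ sᶜ ⊆ E ∧ ν.toFun E = 0}
  univ_sets := ⟨∅, MeasurableSet.empty, by simp, by
    rw [ν.eq_zero_iff MeasurableSet.empty]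
    simp⟩
  sets_of_superset := fun ⟨E, h1, h2, h3⟩ hst =>
    ⟨E, h1, (Set.compl_subset_compl.mpr hst).trans h2, h3⟩
  inter_sets := fun ⟨E, h1, h2, h3⟩ ⟨F, h4, h5, h6⟩ =>
    ⟨E ∪ F, h1.union h4, by rw [Set.compl_inter]; exact Set.union_subset_union h2 h5,
      ν.union_eq_zero h1 h4 h3 h6⟩

lemma ae_inducedMeasure_le (s : State b) : MeasureTheory.ae (ν.inducedMeasure s) ≤ ν.ae := by
  rintro t ⟨E, h1, h2, h3⟩
  exact measure_mono_null h2 ((ν.eq_zero_iff h1).1 h3 s)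

end POVM

/-! ### Quantum random variables, the space `L^∞_H(X, ν)` and its predual -/

/-- Quantum random variables: `x ↦ tr(s f(x))` is measurable for every state `s`. -/
def IsQuantumRandomVariable (b : HilbertBasis ι ℂ H) (f : X → (H →L[ℂ] H)) : Prop :=
  ∀ s : State b, Measurable fun x => trace b (s.op * f x)

namespace POVM

variable {b : HilbertBasis ι ℂ H} (ν : POVM X b)

/-- The vector space of quantum random variables which are essentially bounded with respect to `ν`
(before identification of almost everywhere equal functions). -/
def EssBounded : Submodule ℂ (X → (H →L[ℂ] H)) where
  carrier := {f | IsQuantumRandomVariable b f ∧ ∃ M : ℝ, ∀ᶠ x in ν.ae, ‖f x‖ ≤ M}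
  zero_mem' := ⟨fun s => by simp [trace], 0, by simp⟩
  add_mem' := by
    rintro f g ⟨hf, M, hM⟩ ⟨hg, N, hN⟩
    refine ⟨fun s => ?_, M + N, ?_⟩
    · simp only [Pi.add_apply, s.trace_add]
      exact (hf s).add (hg s)
    · filter_upwards [hM, hN] with x h1 h2
      exact (norm_add_le _ _).trans (add_le_add h1 h2)
  smul_mem' := by
    rintro c f ⟨hf, M, hM⟩
    refine ⟨fun s => ?_, ‖c‖ * M, ?_⟩
    · simp only [Pi.smul_apply, s.trace_smul]
      exact (hf s).const_mul c
    · filter_upwards [hM] with x h1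
      rw [Pi.smul_apply, norm_smul]
      gcongr

/-- The essentially bounded quantum random variables that vanish `ν`-almost everywhere. -/
def nullFunctions : Submodule ℂ ν.EssBounded where
  carrier := {f | f.1 =ᶠ[ν.ae] 0}
  zero_mem' := EventuallyEq.refl ν.ae (0 : X → (H →L[ℂ] H))
  add_mem' := fun {f g} (hf : f.1 =ᶠ[ν.ae] 0) (hg : g.1 =ᶠ[ν.ae] 0) => by
    have h : f.1 + g.1 =ᶠ[ν.ae] 0 := by simpa using hf.add hg
    exact h
  smul_mem' := fun c f (hf : f.1 =ᶠ[ν.ae] 0) => by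
    have h : c • f.1 =ᶠ[ν.ae] 0 := by simpa using hf.const_smul c
    exact h

/-- The space `L^∞_H(X, ν)` of (classes of) essentially bounded quantum random variables. -/
abbrev Linfty : Type _ := ν.EssBounded ⧸ ν.nullFunctions

variable {ν} in
lemma ae_eq_of_rel {f g : ν.EssBounded} (h : (Submodule.quotientRel ν.nullFunctions) f g) :
    f.1 =ᶠ[ν.ae] g.1 := by
  rw [Submodule.quotientRel_def] at h
  have h' : (f - g).1 =ᶠ[ν.ae] 0 := h
  filter_upwards [h'] with x hx
  simpa [sub_eq_zero] using hx

/-- The elements of the predual `L^1(X, ν_ρ) ⊗̄ T(H) = L^1(X, ν_ρ; T(H))`, as functions: measurable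
`g` with `∫ ‖g(x)‖₁ dν_ρ(x) < ∞` (so `g(x)` is trace class for `ν_ρ`-almost all `x`). -/
def MemPredual (ρ : State b) (g : X → (H →L[ℂ] H)) : Prop :=
  IsQuantumRandomVariable b g ∧ ∫⁻ x, traceNorm b (g x) ∂ν.inducedMeasure ρ < ∞

/-- The duality pairing `∫ tr(g(x) f(x)) dν_ρ(x)` of the predual with `L^∞_H(X, ν)`. -/
def pairing (ρ : State b) (g : X → (H →L[ℂ] H)) : ν.Linfty → ℂ :=
  Quotient.lift (s := Submodule.quotientRel ν.nullFunctions)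
    (fun f => ∫ x, trace b (g x * f.1 x) ∂ν.inducedMeasure ρ)
    (fun f f' h => integral_congr_ae <| by
      filter_upwards [(ae_eq_of_rel h).filter_mono (ν.ae_inducedMeasure_le ρ)] with x hx
      simp only [hx])

/-- The weak* topology on `L^∞_H(X, ν)`: the coarsest topology for which the pairing with every
element of the predual is continuous. -/
@[reducible] def weakStar (ρ : State b) : TopologicalSpace ν.Linfty :=
  ⨅ g : {g : X → (H →L[ℂ] H) // ν.MemPredual ρ g},
    TopologicalSpace.induced (ν.pairing ρ g.1) inferInstance

/-! ### The Radon–Nikodým derivative and the quantum expected value -/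

/-- `D` is (a version of) the Radon–Nikodým derivative `dν/dν_ρ`: a quantum random variable, with
bounded operators as values, whose matrix entries in the basis `eᵢ` are the classical
Radon–Nikodým derivatives of the complex measures `ν_ij(E) = ⟨ν(E) eⱼ, eᵢ⟩` with respect to
`ν_ρ`. -/
structure IsRNDeriv (ρ : State b) (D : X → (H →L[ℂ] H)) : Prop where
  isQuantumRandomVariable : IsQuantumRandomVariable b D
  integrable : ∀ i j, Integrable (fun x => inner ℂ (b i) (D x (b j))) (ν.inducedMeasure ρ)
  setIntegral_eq : ∀ i j, ∀ E, MeasurableSet E →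
    ∫ x in E, inner ℂ (b i) (D x (b j)) ∂ν.inducedMeasure ρ = inner ℂ (b i) (ν.toFun E (b j))

end POVM

/-- The function `f_s(x) = tr(s D(x)^{1/2} f(x) D(x)^{1/2})`. -/
def scalarDensity {b : HilbertBasis ι ℂ H} (D f : X → (H →L[ℂ] H)) (s : State b) (x : X) : ℂ :=
  trace b (s.op * CFC.sqrt (D x) * f x * CFC.sqrt (D x))

namespace POVM

variable {b : HilbertBasis ι ℂ H} (ν : POVM X b)

/-- `ν`-integrability of a positive quantum random variable: `f_s` is `ν_ρ`-integrable for every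
state `s`. -/
def IntegrablePos (ρ : State b) (D f : X → (H →L[ℂ] H)) : Prop :=
  ∀ s : State b, Integrable (scalarDensity D f s) (ν.inducedMeasure ρ)

/-- `ν`-integrability of a quantum random variable: the positive and negative parts of its real
and imaginary parts are `ν`-integrable. -/
def QIntegrable (ρ : State b) (D f : X → (H →L[ℂ] H)) : Prop :=
  ν.IntegrablePos ρ D (fun x => (ℜ (f x) : H →L[ℂ] H)⁺) ∧
  ν.IntegrablePos ρ D (fun x => (ℜ (f x) : H →L[ℂ] H)⁻) ∧
  ν.IntegrablePos ρ D (fun x => (ℑ (f x) : H →L[ℂ] H)⁺) ∧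
  ν.IntegrablePos ρ D (fun x => (ℑ (f x) : H →L[ℂ] H)⁻)

/-- `f` is `ν`-integrable and the operator `A` is its integral `∫ f dν`, that is,
`tr(s A) = ∫ f_s dν_ρ` for every state `s`. -/
def HasQIntegral (ρ : State b) (D f : X → (H →L[ℂ] H)) (A : H →L[ℂ] H) : Prop :=
  ν.QIntegrable ρ D f ∧
    ∀ s : State b, trace b (s.op * A) = ∫ x, scalarDensity D f s x ∂ν.inducedMeasure ρ

open Classical in
/-- The integral `∫ f dν` of a quantum random variable (zero if it does not exist). -/
def qIntegral (ρ : State b) (D f : X → (H →L[ℂ] H)) : H →L[ℂ] H :=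
  if h : ∃ A, ν.HasQIntegral ρ D f A then h.choose else 0

variable {ν} in
lemma IntegrablePos.congr {ρ : State b} {D f g : X → (H →L[ℂ] H)} (hf : ν.IntegrablePos ρ D f)
    (h : f =ᵐ[ν.inducedMeasure ρ] g) : ν.IntegrablePos ρ D g := fun s => by
  refine (hf s).congr ?_
  filter_upwards [h] with x hx
  simp only [scalarDensity, hx]

variable {ν} in
lemma HasQIntegral.congr {ρ : State b} {D f g : X → (H →L[ℂ] H)} {A : H →L[ℂ] H}
    (hf : ν.HasQIntegral ρ D f A) (h : f =ᵐ[ν.inducedMeasure ρ] g) : ν.HasQIntegral ρ D g A := by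
  obtain ⟨⟨h1, h2, h3, h4⟩, h5⟩ := hf
  refine ⟨⟨h1.congr ?_, h2.congr ?_, h3.congr ?_, h4.congr ?_⟩, fun s => ?_⟩
  any_goals
    filter_upwards [h] with x hx
    simp only [hx]
  rw [h5 s]
  refine integral_congr_ae ?_
  filter_upwards [h] with x hx
  simp only [scalarDensity, hx]

/-- The quantum expected value map `E_ν(f) = ∫ f dν` on `L^∞_H(X, ν)`. -/
def expectation (ρ : State b) (D : X → (H →L[ℂ] H)) : ν.Linfty → (H →L[ℂ] H) :=
  Quotient.lift (s := Submodule.quotientRel ν.nullFunctions)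
    (fun f => ν.qIntegral ρ D f.1)
    (fun f f' h => by
      have he := (ae_eq_of_rel h).filter_mono (ν.ae_inducedMeasure_le ρ)
      have hp : ν.HasQIntegral ρ D f.1 = ν.HasQIntegral ρ D f'.1 := by
        ext A
        exact ⟨fun hA => hA.congr he, fun hA => hA.congr he.symm⟩
      unfold qIntegral
      rw [hp])

end POVM

end QuantumExpectation

end

open QuantumExpectation

/-!
Since `∫ ⟪v, D v⟫ dν_ρ = ⟪v, ν(X) v⟫`, the map `V v = D(·)^{1/2} v` is a bounded operator from `H`
to `L²(ν_ρ; H)`, and the expected value is the compression `E_ν(f) = V* f V`. A trace class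
operator is a product `T = A B` of two Hilbert–Schmidt operators, and `V A`, `V B*` are then square
integrable in the Hilbert–Schmidt norm. This puts `D^{1/2} T D^{1/2}` into the predual and permits
exchanging trace and integral: `tr(T E_ν(f)) = ∫ tr(D^{1/2} T D^{1/2} f) dν_ρ`. So `E_ν` is the
adjoint of the map `T ↦ D^{1/2} T D^{1/2}` between the preduals.
-/

namespace QuantumExpectation

section HilbertSchmidt

theorem mul_le_sq_add_sq (x y : ℝ) : x * y ≤ x ^ 2 + y ^ 2 := by
  nlinarith [sq_nonneg (x - y), sq_nonneg x, sq_nonneg y]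

variable {H : Type*} [NormedAddCommGroup H] [InnerProductSpace ℂ H]
variable {ι : Type*} {b : HilbertBasis ι ℂ H} {A B S : H →L[ℂ] H}

/-- The square `∑ ‖S eᵢ‖² ∈ [0, ∞]` of the Hilbert–Schmidt norm. It does not depend on the
orthonormal basis. -/
noncomputable def hsNormSq (b : HilbertBasis ι ℂ H) (S : H →L[ℂ] H) : ℝ≥0∞ :=
  ∑' i, ‖S (b i)‖ₑ ^ 2

/-- Hilbert–Schmidt operators; the products of two of them are the trace class operators. -/
def IsHilbertSchmidt (b : HilbertBasis ι ℂ H) (S : H →L[ℂ] H) : Prop :=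
  hsNormSq b S < ∞

theorem hsNormSq_mul_le (b : HilbertBasis ι ℂ H) (A S : H →L[ℂ] H) :
    hsNormSq b (A * S) ≤ ‖A‖ₑ ^ 2 * hsNormSq b S := by
  simp only [hsNormSq, ← ENNReal.tsum_mul_left, ← mul_pow]
  gcongr
  exact A.le_opENorm _

theorem IsHilbertSchmidt.mul_left (hS : IsHilbertSchmidt b S) (A : H →L[ℂ] H) :
    IsHilbertSchmidt b (A * S) :=
  (hsNormSq_mul_le b A S).trans_lt (ENNReal.mul_lt_top (by finiteness) hS)

theorem IsHilbertSchmidt.summable (hS : IsHilbertSchmidt b S) :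
    Summable fun i => ‖S (b i)‖ ^ 2 := by
  simpa using ENNReal.summable_toReal hS.ne

theorem isHilbertSchmidt_of_summable (hS : Summable fun i => ‖S (b i)‖ ^ 2) :
    IsHilbertSchmidt b S := by
  simp only [IsHilbertSchmidt, hsNormSq, ← ofReal_norm, ← ENNReal.ofReal_pow (norm_nonneg _)]
  exact hS.tsum_ofReal_lt_top

variable [CompleteSpace H]

theorem inner_star_left (T : H →L[ℂ] H) (x y : H) : inner ℂ (star T x) y = inner ℂ x (T y) :=
  T.adjoint_inner_left y x

theorem inner_star_right (T : H →L[ℂ] H) (x y : H) : inner ℂ x (star T y) = inner ℂ (T x) y :=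
  T.adjoint_inner_right x y

theorem tsum_enorm_inner_sq (b : HilbertBasis ι ℂ H) (x : H) :
    ∑' i, ‖inner ℂ (b i) x‖ₑ ^ 2 = ‖x‖ₑ ^ 2 := by
  have h := hasSum_norm_sq b x
  simp only [← ofReal_norm, ← ENNReal.ofReal_pow (norm_nonneg _)]
  rw [← ENNReal.ofReal_tsum_of_nonneg (fun i => sq_nonneg _) h.summable, h.tsum_eq]

theorem hsNormSq_star (b : HilbertBasis ι ℂ H) (S : H →L[ℂ] H) :
    hsNormSq b (star S) = hsNormSq b S := by
  simp only [hsNormSq, ← tsum_enorm_inner_sq b]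
  rw [ENNReal.tsum_comm]
  simp only [inner_star_right, ← ofReal_norm, norm_inner_symm (S _)]

theorem IsHilbertSchmidt.star (hS : IsHilbertSchmidt b S) : IsHilbertSchmidt b (star S) := by
  rwa [IsHilbertSchmidt, hsNormSq_star]

theorem IsHilbertSchmidt.mul_right (hS : IsHilbertSchmidt b S) (A : H →L[ℂ] H) :
    IsHilbertSchmidt b (S * A) := by
  simpa using (hS.star.mul_left (Star.star A)).star

theorem IsHilbertSchmidt.hasSum_inner_star (hA : IsHilbertSchmidt b A)
    (hB : IsHilbertSchmidt b B) :
    HasSum (fun i => inner ℂ (Star.star B (b i)) (Star.star A (b i)))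
      (trace b (Star.star A * B)) := by
  let F : ι × ι → ℂ := fun p => inner ℂ (A (b p.1)) (b p.2) * inner ℂ (b p.2) (B (b p.1))
  have hle (p : ι × ι) : ‖F p‖ ≤
      ‖inner ℂ (b p.2) (A (b p.1))‖ ^ 2 + ‖inner ℂ (b p.2) (B (b p.1))‖ ^ 2 := by
    rw [norm_mul, norm_inner_symm (A _)]
    exact mul_le_sq_add_sq _ _
  have hF : Summable F := .of_norm_bounded
    ((summable_prod_norm_sq hA.summable).add (summable_prod_norm_sq hB.summable)) hle
  have hrow (i : ι) : HasSum (fun j => F (i, j)) (inner ℂ (b i) ((Star.star A * B) (b i))) := by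
    rw [mul_apply_eq_comp, inner_star_right]
    exact b.hasSum_inner_mul_inner (A (b i)) (B (b i))
  have hcol (j : ι) : HasSum (fun i => F (i, j))
      (inner ℂ (Star.star B (b j)) (Star.star A (b j))) := by
    have h := b.hasSum_inner_mul_inner (Star.star B (b j)) (Star.star A (b j))
    simpa only [inner_star_left, inner_star_right, mul_comm, F] using h
  have htrace : trace b (Star.star A * B) = ∑' p, F p := (hF.hasSum.prod_fiberwise hrow).tsum_eq
  rw [htrace]
  exact ((Equiv.prodComm ι ι).hasSum_iff.mpr hF.hasSum).prod_fiberwise hcol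

end HilbertSchmidt

section TraceClass

theorem exists_contraction_comp_eq {𝕜 E F G : Type*} [RCLike 𝕜]
    [NormedAddCommGroup E] [NormedSpace 𝕜 E]
    [NormedAddCommGroup F] [InnerProductSpace 𝕜 F] [CompleteSpace F]
    [NormedAddCommGroup G] [NormedSpace 𝕜 G] [CompleteSpace G]
    {S : E →L[𝕜] F} {T : E →L[𝕜] G} (h : ∀ x, ‖T x‖ ≤ ‖S x‖) :
    ∃ W : F →L[𝕜] G, ‖W‖ ≤ 1 ∧ W ∘L S = T := by
  let K := S.range.topologicalClosure
  let e : E →ₗ[𝕜] K :=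
    S.toLinearMap.codRestrict K fun x => Submodule.le_topologicalClosure _ ⟨x, rfl⟩
  have he : DenseRange e := by
    intro k
    rw [Metric.mem_closure_iff]
    intro ε hε
    obtain ⟨_, ⟨x, rfl⟩, hx⟩ := Metric.mem_closure_iff.1 k.2 ε hε
    exact ⟨e x, ⟨x, rfl⟩, hx⟩
  have hle (x : E) : ‖T x‖ ≤ 1 * ‖e x‖ := (h x).trans_eq (one_mul _).symm
  have : CompleteSpace K := (Submodule.isClosed_topologicalClosure _).completeSpace_coe
  let V : K →L[𝕜] G := T.toLinearMap.extendOfNorm e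
  refine ⟨V ∘L K.orthogonalProjectionOnto, ?_, ContinuousLinearMap.ext fun x => ?_⟩
  · exact (ContinuousLinearMap.opNorm_comp_le _ _).trans <|
      mul_le_one₀ (LinearMap.opNorm_extendOfNorm_le he zero_le_one hle) (norm_nonneg _)
        K.orthogonalProjectionOnto_norm_le
  · calc V (K.orthogonalProjectionOnto (e x)) = V (e x) := by
          rw [K.orthogonalProjectionOnto_mem_subspace_eq_self]
      _ = T x := LinearMap.extendOfNorm_eq he ⟨1, hle⟩ x

variable {H : Type*} [NormedAddCommGroup H] [InnerProductSpace ℂ H] [CompleteSpace H]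
variable {ι : Type*} {b : HilbertBasis ι ℂ H} {A B S T : H →L[ℂ] H}

theorem norm_abs_apply (T : H →L[ℂ] H) (x : H) : ‖CFC.abs T x‖ = ‖T x‖ := by
  have h : inner ℂ (CFC.abs T x) (CFC.abs T x) = inner ℂ (T x) (T x) := by
    rw [← inner_star_right, (IsSelfAdjoint.of_nonneg (CFC.abs_nonneg T)).star_eq,
      ← mul_apply_eq_comp, CFC.abs_mul_abs, mul_apply_eq_comp, inner_star_right]
  rw [inner_self_eq_norm_sq_to_K, inner_self_eq_norm_sq_to_K] at h
  rw [← sq_eq_sq₀ (norm_nonneg _) (norm_nonneg _)]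
  exact_mod_cast h

theorem traceNorm_star_mul_le (b : HilbertBasis ι ℂ H) (A B : H →L[ℂ] H) :
    traceNorm b (star A * B) ≤ hsNormSq b A + hsNormSq b B := by
  obtain ⟨W, hW, hWT⟩ := exists_contraction_comp_eq fun x => (norm_abs_apply (star A * B) x).le
  have hterm (i : ι) : ENNReal.ofReal (inner ℂ (b i) (CFC.abs (star A * B) (b i))).re ≤
      ‖(A * star W) (b i)‖ₑ ^ 2 + ‖B (b i)‖ₑ ^ 2 := by
    have hinner : inner ℂ (b i) (CFC.abs (star A * B) (b i)) =
        inner ℂ ((A * star W) (b i)) (B (b i)) := by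
      rw [← hWT]
      simp only [ContinuousLinearMap.comp_apply, mul_apply_eq_comp]
      rw [← inner_star_right, inner_star_left]
    rw [hinner]
    simp only [← ofReal_norm, ← ENNReal.ofReal_pow (norm_nonneg _)]
    rw [← ENNReal.ofReal_add (sq_nonneg _) (sq_nonneg _)]
    refine ENNReal.ofReal_le_ofReal ?_
    calc _ ≤ ‖inner ℂ ((A * star W) (b i)) (B (b i))‖ := Complex.re_le_norm _
      _ ≤ ‖(A * star W) (b i)‖ * ‖B (b i)‖ := norm_inner_le_norm _ _
      _ ≤ _ := mul_le_sq_add_sq _ _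
  have hAW : hsNormSq b (A * star W) ≤ hsNormSq b A := by
    rw [← hsNormSq_star, ← hsNormSq_star b A, star_mul, star_star]
    refine (hsNormSq_mul_le b W _).trans (mul_le_of_le_one_left' (pow_le_one' ?_ 2))
    rwa [← ofReal_norm, ENNReal.ofReal_le_one]
  calc traceNorm b (star A * B)
      ≤ ∑' i, (‖(A * star W) (b i)‖ₑ ^ 2 + ‖B (b i)‖ₑ ^ 2) := ENNReal.tsum_le_tsum hterm
    _ = hsNormSq b (A * star W) + hsNormSq b B := ENNReal.tsum_add
    _ ≤ hsNormSq b A + hsNormSq b B := by gcongr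

theorem isTraceClass_iff_exists_star_mul :
    IsTraceClass b T ↔
      ∃ A B, IsHilbertSchmidt b A ∧ IsHilbertSchmidt b B ∧ T = star A * B := by
  constructor
  · intro hT
    obtain ⟨W, -, hWT⟩ := exists_contraction_comp_eq fun x => (norm_abs_apply T x).ge
    let R := CFC.sqrt (CFC.abs T)
    have hR : IsHilbertSchmidt b R := by
      refine isHilbertSchmidt_of_summable (summable_sqrt (CFC.abs_nonneg T) ?_)
      rwa [IsTraceClass, traceNorm, CFC.abs_of_nonneg _ (CFC.abs_nonneg T)]
    refine ⟨star (W * R), R, (hR.mul_left W).star, hR, ?_⟩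
    rw [star_star, mul_assoc, CFC.sqrt_mul_sqrt_self _ (CFC.abs_nonneg T)]
    exact hWT.symm
  · rintro ⟨A, B, hA, hB, rfl⟩
    exact (traceNorm_star_mul_le b A B).trans_lt (ENNReal.add_lt_top.2 ⟨hA, hB⟩)

theorem IsTraceClass.mul_right (hT : IsTraceClass b T) (S : H →L[ℂ] H) :
    IsTraceClass b (T * S) := by
  rw [isTraceClass_iff_exists_star_mul] at hT ⊢
  obtain ⟨A, B, hA, hB, rfl⟩ := hT
  exact ⟨A, B * S, hA, hB.mul_right S, mul_assoc _ _ _⟩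

theorem IsTraceClass.mul_left (hT : IsTraceClass b T) (S : H →L[ℂ] H) :
    IsTraceClass b (S * T) := by
  rw [isTraceClass_iff_exists_star_mul] at hT ⊢
  obtain ⟨A, B, hA, hB, rfl⟩ := hT
  exact ⟨A * star S, B, hA.mul_right _, hB, by rw [star_mul, star_star, mul_assoc]⟩

theorem IsTraceClass.trace_mul_comm (hT : IsTraceClass b T) (S : H →L[ℂ] H) :
    trace b (T * S) = trace b (S * T) := by
  obtain ⟨A, B, hA, hB, rfl⟩ := isTraceClass_iff_exists_star_mul.1 hT
  have hl := hA.hasSum_inner_star (hB.mul_right S)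
  have hr := (hA.mul_right (star S)).hasSum_inner_star hB
  simp only [star_mul, star_star, mul_apply_eq_comp, inner_star_left S] at hl hr
  rw [mul_assoc, ← mul_assoc S]
  exact hl.unique hr

end TraceClass

section Separable

variable {𝕜 E : Type*} [RCLike 𝕜] [NormedAddCommGroup E] [InnerProductSpace 𝕜 E]
variable [TopologicalSpace.SeparableSpace E]

theorem countable_of_orthonormal {ι : Type*} {v : ι → E} (hv : Orthonormal 𝕜 v) :
    Countable ι := by
  refine Pairwise.countable_of_isOpen_disjoint (s := fun i => Metric.ball (v i) (1 / 2))
    (fun i j hij => Metric.ball_disjoint_ball ?_) (fun _ => Metric.isOpen_ball)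
    (fun i => ⟨v i, Metric.mem_ball_self (by norm_num)⟩)
  have h := norm_sub_sq (𝕜 := 𝕜) (v i) (v j)
  rw [hv.2 hij, hv.1, hv.1, ← dist_eq_norm, map_zero] at h
  nlinarith [dist_nonneg (x := v i) (y := v j)]

variable [CompleteSpace E] {X : Type*} [MeasurableSpace X]

theorem stronglyMeasurable_of_measurable_inner {f : X → E}
    (hf : ∀ u, Measurable fun x => inner 𝕜 u (f x)) : StronglyMeasurable f := by
  obtain ⟨κ, b, -⟩ := exists_hilbertBasis 𝕜 E
  have := countable_of_orthonormal b.orthonormal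
  refine stronglyMeasurable_of_tendsto atTop
    (f := fun (t : Finset κ) x => ∑ i ∈ t, inner 𝕜 (b i : E) (f x) • (b i : E))
    (fun t => Finset.stronglyMeasurable_fun_sum t fun i _ =>
      (hf (b i)).stronglyMeasurable.smul_const (b i : E)) (tendsto_pi_nhds.2 fun x => ?_)
  simpa only [HasSum, SummationFilter.unconditional_filter, b.repr_apply_apply]
    using b.hasSum_repr (f x)

end Separable

variable {H : Type*} [NormedAddCommGroup H] [InnerProductSpace ℂ H]
variable {X : Type*} [MeasurableSpace X] {F G : X → (H →L[ℂ] H)}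

/-- Measurability of an operator-valued function in the weak operator topology, i.e. of all its
matrix elements. -/
def WeaklyMeasurable (F : X → (H →L[ℂ] H)) : Prop :=
  ∀ u v, Measurable fun x => inner ℂ u (F x v)

namespace WeaklyMeasurable

theorem const (A : H →L[ℂ] H) : WeaklyMeasurable fun _ : X => A :=
  fun _ _ => measurable_const

theorem add (hF : WeaklyMeasurable F) (hG : WeaklyMeasurable G) :
    WeaklyMeasurable fun x => F x + G x := fun u v => by
  simpa only [add_apply, inner_add_right] using (hF u v).fun_add (hG u v)

theorem smul (hF : WeaklyMeasurable F) (c : ℂ) : WeaklyMeasurable fun x => c • F x :=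
  fun u v => by simpa only [smul_apply, inner_smul_right] using (hF u v).const_mul c

theorem real_smul (hF : WeaklyMeasurable F) (c : ℝ) : WeaklyMeasurable fun x => c • F x := by
  simpa only [Complex.coe_smul] using hF.smul (c : ℂ)

theorem indicator (hF : WeaklyMeasurable F) {E : Set X} (hE : MeasurableSet E) :
    WeaklyMeasurable (E.indicator F) := fun u v => by
  have h (x : X) : inner ℂ u (E.indicator F x v) = E.indicator (fun x => inner ℂ u (F x v)) x := by
    by_cases hx : x ∈ E <;> simp [hx]
  simpa only [h] using (hF u v).indicator hE

theorem of_tendsto {F : ℕ → X → (H →L[ℂ] H)} (hF : ∀ n, WeaklyMeasurable (F n))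
    (h : ∀ x, Tendsto (fun n => F n x) atTop (𝓝 (G x))) : WeaklyMeasurable G := fun u v => by
  refine measurable_of_tendsto_metrizable (fun n => hF n u v) (tendsto_pi_nhds.2 fun x => ?_)
  have hc : Continuous fun A : H →L[ℂ] H => inner ℂ u (A v) := by fun_prop
  exact (hc.tendsto _).comp (h x)

variable [CompleteSpace H]

theorem star (hF : WeaklyMeasurable F) : WeaklyMeasurable fun x => star (F x) := fun u v => by
  simp only [inner_star_right, ← inner_conj_symm _ v]
  exact Complex.continuous_conj.measurable.comp (hF v u)

theorem realPart (hF : WeaklyMeasurable F) :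
    WeaklyMeasurable fun x => (ℜ (F x) : H →L[ℂ] H) := by
  simpa only [realPart_apply_coe] using (hF.add hF.star).real_smul _

theorem imaginaryPart (hF : WeaklyMeasurable F) :
    WeaklyMeasurable fun x => (ℑ (F x) : H →L[ℂ] H) := by
  have h (A : H →L[ℂ] H) : ℑ A = ℜ ((-Complex.I) • A) := by simp
  simpa only [h] using (hF.smul _).realPart

variable [TopologicalSpace.SeparableSpace H]

theorem stronglyMeasurable_apply (hF : WeaklyMeasurable F) (v : H) :
    StronglyMeasurable fun x => F x v :=
  stronglyMeasurable_of_measurable_inner (𝕜 := ℂ) fun u => hF u v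

theorem mul (hF : WeaklyMeasurable F) (hG : WeaklyMeasurable G) :
    WeaklyMeasurable fun x => F x * G x := fun u v => by
  simpa only [mul_apply_eq_comp, inner_star_left] using
    ((hF.star.stronglyMeasurable_apply u).inner (𝕜 := ℂ) (hG.stronglyMeasurable_apply v)).measurable

theorem aeval (hF : WeaklyMeasurable F) (p : Polynomial ℝ) :
    WeaklyMeasurable fun x => Polynomial.aeval (F x) p := by
  have hpow (n : ℕ) : WeaklyMeasurable fun x => F x ^ n := by
    induction n with
    | zero => simpa only [pow_zero] using const 1
    | succ n ih => simpa only [pow_succ] using ih.mul hF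
  induction p using Polynomial.induction_on' with
  | add p q hp hq => simpa only [map_add] using hp.add hq
  | monomial n r =>
    simpa only [Polynomial.aeval_monomial, Algebra.algebraMap_eq_smul_one, smul_mul_assoc, one_mul]
      using (hpow n).real_smul r

theorem cfc (hF : WeaklyMeasurable F) (hs : ∀ x, IsSelfAdjoint (F x)) {g : ℝ → ℝ}
    (hg : Continuous g) : WeaklyMeasurable fun x => cfc g (F x) := by
  have happrox (n : ℕ) : ∃ p : Polynomial ℝ, ∀ t ∈ Set.Icc (-(n : ℝ)) n,
      |p.eval t - g t| < 1 / ((n : ℝ) + 1) :=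
    exists_polynomial_near_of_continuousOn _ _ g hg.continuousOn _ Nat.one_div_pos_of_nat
  choose p hp using happrox
  refine of_tendsto (fun n => hF.aeval (p n)) fun x => ?_
  rw [tendsto_iff_norm_sub_tendsto_zero]
  refine squeeze_zero' (Eventually.of_forall fun n => norm_nonneg _) ?_
    (tendsto_one_div_add_atTop_nhds_zero_nat (𝕜 := ℝ))
  filter_upwards [eventually_ge_atTop ⌈‖F x‖⌉₊] with n hn
  rw [← cfc_polynomial (p n) (F x) (hs x),
    ← cfc_sub (p n).eval g (F x) (p n).continuous.continuousOn hg.continuousOn]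
  refine norm_cfc_le (by positivity) fun t ht => (hp n t ?_).le
  have ht' : ‖t‖ ≤ ‖F x‖ := (spectrum.norm_le_norm_mul_of_mem ht).trans
    (mul_le_of_le_one_right (norm_nonneg _) ContinuousLinearMap.norm_id_le)
  exact abs_le.1 (ht'.trans (Nat.ceil_le.1 hn))

theorem posPart (hF : WeaklyMeasurable F) (hs : ∀ x, IsSelfAdjoint (F x)) :
    WeaklyMeasurable fun x => (F x)⁺ := by
  have h (x : X) : (F x)⁺ = _root_.cfc (fun t : ℝ => t⁺) (F x) := by
    rw [CFC.posPart_def, cfcₙ_eq_cfc]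
  simpa only [h] using hF.cfc hs (by fun_prop)

theorem negPart (hF : WeaklyMeasurable F) (hs : ∀ x, IsSelfAdjoint (F x)) :
    WeaklyMeasurable fun x => (F x)⁻ := by
  have h (x : X) : (F x)⁻ = _root_.cfc (fun t : ℝ => t⁻) (F x) := by
    rw [CFC.negPart_def, cfcₙ_eq_cfc]
  simpa only [h] using hF.cfc hs (by fun_prop)

end WeaklyMeasurable

section Order

open scoped ComplexOrder

theorem nonneg_iff_inner_nonneg_of_denseRange [CompleteSpace H] {A : H →L[ℂ] H} {κ : Type*}
    {d : κ → H} (hd : DenseRange d) : 0 ≤ A ↔ ∀ n, 0 ≤ inner ℂ (d n) (A (d n)) := by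
  rw [ContinuousLinearMap.nonneg_iff_isPositive]
  refine ⟨fun h n => h.inner_nonneg_right _, fun h => ?_⟩
  have hv (v : H) : 0 ≤ inner ℂ v (A v) :=
    hd.induction_on v (isClosed_le continuous_const (by fun_prop)) h
  rw [ContinuousLinearMap.isPositive_iff_complex]
  intro v
  have hv' : 0 ≤ inner ℂ (A v) v := by
    rw [← inner_conj_symm]
    exact star_nonneg_iff.2 (hv v)
  exact ⟨(Complex.eq_re_of_ofReal_le (r := 0) (by simpa using hv')).symm,
    (Complex.nonneg_iff.1 hv').1⟩

theorem WeaklyMeasurable.measurableSet_nonneg [CompleteSpace H]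
    [TopologicalSpace.SeparableSpace H] (hF : WeaklyMeasurable F) :
    MeasurableSet {x | 0 ≤ F x} := by
  simp only [nonneg_iff_inner_nonneg_of_denseRange (TopologicalSpace.denseRange_denseSeq H),
    Set.ofPred_forall]
  exact MeasurableSet.iInter fun n => measurableSet_le measurable_const (hF _ _)

end Order

theorem exists_state_forall_inner_eq [CompleteSpace H] {ι : Type*} (b : HilbertBasis ι ℂ H) {v : H}
    (hv : v ≠ 0) :
    ∃ s : State b, ∀ A : H →L[ℂ] H, inner ℂ v (A v) = ‖v‖ ^ 2 * trace b (s.op * A) := by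
  have hunit : ‖((‖v‖⁻¹ : ℝ) : ℂ) • v‖ = 1 := by simp [norm_smul, hv]
  refine ⟨pureState b _ hunit, fun A => ?_⟩
  have hne : (‖v‖ : ℂ) ≠ 0 := by simpa using hv
  rw [trace_pureState, map_smul, inner_smul_left, inner_smul_right, Complex.conj_ofReal]
  push_cast
  field_simp

variable [CompleteSpace H] [TopologicalSpace.SeparableSpace H]

theorem WeaklyMeasurable.sqrt (hF : WeaklyMeasurable F) :
    WeaklyMeasurable fun x => CFC.sqrt (F x) := by
  let F' : X → (H →L[ℂ] H) := {x | 0 ≤ F x}.indicator F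
  have hF' (x : X) : 0 ≤ F' x := Set.indicator_apply_nonneg id
  have h (x : X) : CFC.sqrt (F x) = _root_.cfc Real.sqrt (F' x) := by
    rw [← cfcₙ_eq_cfc, ← CFC.sqrt_eq_real_sqrt _ (hF' x)]
    by_cases hx : 0 ≤ F x
    · simp [F', hx]
    · -- junk value of the functional calculus
      simp [F', hx, CFC.sqrt, cfcₙ_apply_of_not_predicate _ hx]
  simpa only [h] using (hF.indicator hF.measurableSet_nonneg).cfc
    (fun x => .of_nonneg (hF' x)) Real.continuous_sqrt

theorem isQuantumRandomVariable_iff_weaklyMeasurable {ι : Type*} (b : HilbertBasis ι ℂ H) :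
    IsQuantumRandomVariable b F ↔ WeaklyMeasurable F := by
  constructor
  · intro h
    have hdiag (v : H) : Measurable fun x => inner ℂ (F x v) v := by
      rcases eq_or_ne v 0 with rfl | hv
      · simp
      obtain ⟨s, hs⟩ := exists_state_forall_inner_eq b hv
      simp only [← inner_conj_symm _ v, hs]
      exact Complex.continuous_conj.measurable.comp ((h s).const_mul _)
    intro u v
    have hoff : Measurable fun x => inner ℂ (F x v) u := by
      have hpol (x : X) := inner_map_polarization (F x : H →ₗ[ℂ] H) u v
      simp only [ContinuousLinearMap.coe_coe] at hpol
      simp only [hpol]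
      exact ((((hdiag _).sub (hdiag _)).add ((hdiag _).const_mul _)).sub
        ((hdiag _).const_mul _)).div_const _
    simp only [← inner_conj_symm u]
    exact Complex.continuous_conj.measurable.comp hoff
  · intro h s
    have := countable_of_orthonormal b.orthonormal
    refine measurable_of_tendsto_metrizable' (f := fun (t : Finset ι) x => ∑ i ∈ t,
      inner ℂ (CFC.sqrt s.op (b i)) (F x (CFC.sqrt s.op (b i)))) atTop
      (fun t => Finset.measurable_fun_sum t fun i _ => h _ _) (tendsto_pi_nhds.2 fun x => ?_)
    exact (hasSum_trace_mul s.nonneg s.isTraceClass (F x)).2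

section SquareIntegrable

variable {X : Type*} [MeasurableSpace X] {μ : Measure X}

theorem integrable_of_hasSum {ι E : Type*} [Countable ι] [NormedAddCommGroup E]
    {f : ι → X → E} {g : X → E} (hf : ∀ i, AEStronglyMeasurable (f i) μ)
    (hsum : ∑' i, ∫⁻ x, ‖f i x‖ₑ ∂μ ≠ ∞) (hg : ∀ x, HasSum (fun i => f i x) (g x)) :
    Integrable g μ := by
  constructor
  · exact aestronglyMeasurable_of_tendsto_ae atTop
      (fun t => Finset.aestronglyMeasurable_fun_sum t fun i _ => hf i) (ae_of_all μ hg)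
  · calc ∫⁻ x, ‖g x‖ₑ ∂μ ≤ ∫⁻ x, ∑' i, ‖f i x‖ₑ ∂μ :=
          lintegral_mono fun x => by
            rw [← (hg x).tsum_eq]
            exact enorm_tsum_le_tsum_enorm
      _ = ∑' i, ∫⁻ x, ‖f i x‖ₑ ∂μ := lintegral_tsum fun i => (hf i).enorm
      _ < ∞ := hsum.lt_top

variable {𝕜 E F : Type*} [RCLike 𝕜] [NormedAddCommGroup E] [NormedAddCommGroup F]

/-- Square integrability, in the strong operator topology, of a field of operators `R x`: all the
functions `x ↦ R x v` are in `L²(μ; F)`. -/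
def SquareIntegrable [NormedSpace 𝕜 E] [NormedSpace 𝕜 F] (μ : Measure X)
    (R : X → (E →L[𝕜] F)) : Prop :=
  ∀ v, MemLp (fun x => R x v) 2 μ

namespace SquareIntegrable

section Banach

variable [NormedSpace 𝕜 E] [NormedSpace 𝕜 F] [CompleteSpace E] [CompleteSpace F]
variable {R : X → (E →L[𝕜] F)}

/-- The operator `v ↦ R(·) v` from `E` to `L²(μ; F)` given by a square integrable field of
operators; it is bounded by the closed graph theorem. -/
noncomputable def toL2 (hR : SquareIntegrable μ R) : E →L[𝕜] Lp F 2 μ :=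
  .ofSeqClosedGraph (g :=
    { toFun := fun v => (hR v).toLp
      map_add' := fun v w => by
        rw [← MemLp.toLp_add]
        exact MemLp.toLp_congr _ _ (ae_of_all μ fun x => map_add (R x) v w)
      map_smul' := fun c v => by
        rw [RingHom.id_apply, ← MemLp.toLp_const_smul]
        exact MemLp.toLp_congr _ _ (ae_of_all μ fun x => map_smul (R x) c v) })
    fun v w y hv hy => by
      obtain ⟨k, hk, hky⟩ := (tendstoInMeasure_of_tendsto_Lp hy).exists_seq_tendsto_ae
      refine Lp.ext (EventuallyEq.trans ?_ (hR w).coeFn_toLp.symm)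
      filter_upwards [hky, ae_all_iff.2 fun n => (hR (v n)).coeFn_toLp] with x hx hvx
      refine tendsto_nhds_unique hx ?_
      exact ((((R x).continuous.tendsto w).comp hv).comp hk.tendsto_atTop).congr
        fun n => (hvx (k n)).symm

theorem coeFn_toL2 (hR : SquareIntegrable μ R) (v : E) : hR.toL2 v =ᵐ[μ] fun x => R x v :=
  (hR v).coeFn_toLp

theorem lintegral_enorm_sq (hR : SquareIntegrable μ R) (v : E) :
    ∫⁻ x, ‖R x v‖ₑ ^ 2 ∂μ = ‖hR.toL2 v‖ₑ ^ 2 := by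
  rw [Lp.enorm_def, eLpNorm_congr_ae (hR.coeFn_toL2 v)]
  have h := eLpNorm_nnreal_pow_eq_lintegral (p := 2) (f := fun x => R x v) (μ := μ) two_ne_zero
  simpa using h.symm

end Banach

section Hilbert

variable [InnerProductSpace 𝕜 E] [InnerProductSpace 𝕜 F] [CompleteSpace E] [CompleteSpace F]
variable {R S : X → (E →L[𝕜] F)}

/-- The operator `∫ R(x)* S(x) dμ(x)`, defined by duality: its sesquilinear form is
`∫ ⟨R(x) u, S(x) v⟩ dμ(x)`. -/
noncomputable def integralAdjointComp (hR : SquareIntegrable μ R) (hS : SquareIntegrable μ S) :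
    E →L[𝕜] E :=
  hR.toL2.adjoint ∘L hS.toL2

theorem inner_integralAdjointComp (hR : SquareIntegrable μ R) (hS : SquareIntegrable μ S)
    (u v : E) :
    inner 𝕜 u (hR.integralAdjointComp hS v) = ∫ x, inner 𝕜 (R x u) (S x v) ∂μ := by
  rw [integralAdjointComp, ContinuousLinearMap.comp_apply,
    ContinuousLinearMap.adjoint_inner_right, L2.inner_def]
  refine integral_congr_ae ?_
  filter_upwards [hR.coeFn_toL2 u, hS.coeFn_toL2 v] with x hu hv
  rw [hu, hv]

end Hilbert

end SquareIntegrable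

end SquareIntegrable

section TraceClassIntegrals

variable {X : Type*} [MeasurableSpace X] {μ : Measure X}
variable {H : Type*} [NormedAddCommGroup H] [InnerProductSpace ℂ H]
variable {ι : Type*} {b : HilbertBasis ι ℂ H} {A B T : H →L[ℂ] H}
variable {F R S : X → (H →L[ℂ] H)}

theorem SquareIntegrable.lintegral_hsNormSq_mul [Countable ι] (hR : SquareIntegrable μ R)
    (A : H →L[ℂ] H) :
    ∫⁻ x, hsNormSq b (R x * A) ∂μ = ∑' i, ∫⁻ x, ‖R x (A (b i))‖ₑ ^ 2 ∂μ :=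
  lintegral_tsum fun i => (hR (A (b i))).1.enorm.pow_const 2

variable [CompleteSpace H]

theorem SquareIntegrable.mul_left [TopologicalSpace.SeparableSpace H]
    (hR : SquareIntegrable μ R) (hRm : WeaklyMeasurable R) (hF : WeaklyMeasurable F) {M : ℝ}
    (hM : ∀ᵐ x ∂μ, ‖F x‖ ≤ M) : SquareIntegrable μ fun x => F x * R x := fun v => by
  refine (hR v).of_le_mul (c := M)
    ((hF.mul hRm).stronglyMeasurable_apply v).aestronglyMeasurable ?_
  filter_upwards [hM] with x hx using (F x).le_of_opNorm_le hx _

theorem IsHilbertSchmidt.hasSum_inner_trace_conj (hA : IsHilbertSchmidt b A)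
    (hB : IsHilbertSchmidt b B) (R S : H →L[ℂ] H) :
    HasSum (fun i => inner ℂ (R (Star.star B (b i))) (S (Star.star A (b i))))
      (trace b (S * (Star.star A * B) * Star.star R)) := by
  simpa [mul_assoc] using
    (hA.mul_right (Star.star S)).hasSum_inner_star (hB.mul_right (Star.star R))

section Countable

variable [Countable ι]

theorem SquareIntegrable.lintegral_hsNormSq_mul_lt_top (hR : SquareIntegrable μ R)
    (hA : IsHilbertSchmidt b A) : ∫⁻ x, hsNormSq b (R x * A) ∂μ < ∞ := by
  calc ∫⁻ x, hsNormSq b (R x * A) ∂μ = ∑' i, ‖hR.toL2 (A (b i))‖ₑ ^ 2 := by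
        simp only [hR.lintegral_hsNormSq_mul, hR.lintegral_enorm_sq]
    _ ≤ ∑' i, ‖hR.toL2‖ₑ ^ 2 * ‖A (b i)‖ₑ ^ 2 := by
        simp only [← mul_pow]
        gcongr
        exact hR.toL2.le_opENorm _
    _ = ‖hR.toL2‖ₑ ^ 2 * hsNormSq b A := ENNReal.tsum_mul_left
    _ < ∞ := ENNReal.mul_lt_top (by finiteness) hA

theorem IsTraceClass.lintegral_traceNorm_conj_lt_top (hT : IsTraceClass b T)
    (hR : SquareIntegrable μ R) (hS : SquareIntegrable μ S) :
    ∫⁻ x, traceNorm b (S x * T * star (R x)) ∂μ < ∞ := by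
  obtain ⟨A, B, hA, hB, rfl⟩ := isTraceClass_iff_exists_star_mul.1 hT
  have hle (x : X) : traceNorm b (S x * (star A * B) * star (R x)) ≤
      hsNormSq b (S x * star A) + hsNormSq b (R x * star B) := by
    have h := traceNorm_star_mul_le b (A * star (S x)) (B * star (R x))
    rw [← hsNormSq_star b (A * _), ← hsNormSq_star b (B * _)] at h
    simpa only [star_mul, star_star, mul_assoc] using h
  have hmeas : AEMeasurable (fun x => hsNormSq b (S x * star A)) μ :=
    .tsum fun i => (hS (star A (b i))).1.enorm.pow_const 2
  refine (lintegral_mono hle).trans_lt ?_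
  rw [lintegral_add_left' hmeas]
  exact ENNReal.add_lt_top.2 ⟨hS.lintegral_hsNormSq_mul_lt_top hA.star,
    hR.lintegral_hsNormSq_mul_lt_top hB.star⟩

theorem SquareIntegrable.tsum_lintegral_enorm_inner_ne_top (hR : SquareIntegrable μ R)
    (hS : SquareIntegrable μ S) (hA : IsHilbertSchmidt b A) (hB : IsHilbertSchmidt b B) :
    ∑' i, ∫⁻ x, ‖inner ℂ (R x (B (b i))) (S x (A (b i)))‖ₑ ∂μ ≠ ∞ := by
  have hle (x y : H) : ‖inner ℂ x y‖ₑ ≤ ‖x‖ₑ ^ 2 + ‖y‖ₑ ^ 2 := by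
    simp only [← ofReal_norm, ← ENNReal.ofReal_pow (norm_nonneg _)]
    rw [← ENNReal.ofReal_add (sq_nonneg _) (sq_nonneg _)]
    exact ENNReal.ofReal_le_ofReal ((norm_inner_le_norm x y).trans (mul_le_sq_add_sq _ _))
  refine ne_top_of_le_ne_top (b := ∫⁻ x, hsNormSq b (R x * B) ∂μ + ∫⁻ x, hsNormSq b (S x * A) ∂μ)
    (ENNReal.add_lt_top.2 ⟨hR.lintegral_hsNormSq_mul_lt_top hB,
      hS.lintegral_hsNormSq_mul_lt_top hA⟩).ne ?_
  rw [hR.lintegral_hsNormSq_mul, hS.lintegral_hsNormSq_mul, ← ENNReal.tsum_add]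
  refine ENNReal.tsum_le_tsum fun i => ?_
  rw [← lintegral_add_left' ((hR _).1.enorm.pow_const 2)]
  exact lintegral_mono fun x => hle _ _

theorem IsTraceClass.integrable_trace_conj (hT : IsTraceClass b T)
    (hR : SquareIntegrable μ R) (hS : SquareIntegrable μ S) :
    Integrable (fun x => trace b (S x * T * star (R x))) μ := by
  obtain ⟨A, B, hA, hB, rfl⟩ := isTraceClass_iff_exists_star_mul.1 hT
  exact integrable_of_hasSum (fun i => (hR _).1.inner (hS _).1)
    (hR.tsum_lintegral_enorm_inner_ne_top hS hA.star hB.star)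
    fun x => hA.hasSum_inner_trace_conj hB (R x) (S x)

theorem IsTraceClass.trace_mul_integralAdjointComp (hT : IsTraceClass b T)
    (hR : SquareIntegrable μ R) (hS : SquareIntegrable μ S) :
    trace b (T * hR.integralAdjointComp hS) = ∫ x, trace b (S x * T * star (R x)) ∂μ := by
  obtain ⟨A, B, hA, hB, rfl⟩ := isTraceClass_iff_exists_star_mul.1 hT
  have hsum := hA.hasSum_inner_star (hB.mul_right (hR.integralAdjointComp hS))
  simp only [star_mul, mul_apply_eq_comp, inner_star_left (hR.integralAdjointComp hS),
    hR.inner_integralAdjointComp] at hsum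
  calc trace b (star A * B * hR.integralAdjointComp hS)
      = ∑' i, ∫ x, inner ℂ (R x (star B (b i))) (S x (star A (b i))) ∂μ := by
        rw [mul_assoc, hsum.tsum_eq]
    _ = ∫ x, ∑' i, inner ℂ (R x (star B (b i))) (S x (star A (b i))) ∂μ :=
        (integral_tsum (fun i => (hR _).1.inner (hS _).1)
          (hR.tsum_lintegral_enorm_inner_ne_top hS hA.star hB.star)).symm
    _ = ∫ x, trace b (S x * (star A * B) * star (R x)) ∂μ := by
        simp only [(hA.hasSum_inner_trace_conj hB _ _).tsum_eq]

end Countable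

end TraceClassIntegrals

section RadonNikodym

open scoped ComplexOrder NNReal

variable {X : Type*} [MeasurableSpace X] {μ : Measure X}

theorem SquareIntegrable.of_dense {𝕜 E F : Type*} [RCLike 𝕜] [NormedAddCommGroup E]
    [NormedAddCommGroup F] [NormedSpace 𝕜 E] [NormedSpace 𝕜 F] {R : X → (E →L[𝕜] F)}
    (hR : ∀ v, AEStronglyMeasurable (fun x => R x v) μ) {S : Set E} (hS : Dense S) {C : ℝ≥0}
    (hC : ∀ v ∈ S, eLpNorm (fun x => R x v) 2 μ ≤ C * ‖v‖ₑ) : SquareIntegrable μ R := by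
  intro v
  obtain ⟨w, hw, hlim⟩ := mem_closure_iff_seq_limit.1 (hS v)
  have hbound : Tendsto (fun n => (C : ℝ≥0∞) * ‖w n‖ₑ) atTop (𝓝 (C * ‖v‖ₑ)) :=
    ENNReal.Tendsto.const_mul ((continuous_enorm.tendsto v).comp hlim) (.inr ENNReal.coe_ne_top)
  refine ⟨hR v, lt_of_le_of_lt ?_ (b := C * ‖v‖ₑ) (by finiteness)⟩
  calc eLpNorm (fun x => R x v) 2 μ ≤ liminf (fun n => eLpNorm (fun x => R x (w n)) 2 μ) atTop :=
        Lp.eLpNorm_lim_le_liminf_eLpNorm (fun n => hR (w n)) _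
          (ae_of_all μ fun x => ((R x).continuous.tendsto v).comp hlim)
    _ ≤ liminf (fun n => (C : ℝ≥0∞) * ‖w n‖ₑ) atTop :=
        liminf_le_liminf (.of_forall fun n => hC _ (hw n))
    _ = C * ‖v‖ₑ := hbound.liminf_eq

theorem ae_nonneg_of_forall_setIntegral_complex_nonneg {f : X → ℂ} (hf : Integrable f μ)
    (h : ∀ E, MeasurableSet E → 0 ≤ ∫ x in E, f x ∂μ) : ∀ᵐ x ∂μ, 0 ≤ f x := by
  have hre : 0 ≤ᵐ[μ] fun x => (f x).re :=
    ae_nonneg_of_forall_setIntegral_nonneg hf.re fun E hE _ =>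
      (Complex.nonneg_iff.1 (h E hE)).1.trans_eq (integral_re hf.integrableOn).symm
  have him : (fun x => (f x).im) =ᵐ[μ] 0 :=
    Integrable.ae_eq_zero_of_forall_setIntegral_eq_zero hf.im fun E hE _ =>
      (integral_im hf.integrableOn).trans (Complex.nonneg_iff.1 (h E hE)).2.symm
  filter_upwards [hre, him] with x hx hx' using Complex.nonneg_iff.2 ⟨hx, hx'.symm⟩

theorem lintegral_enorm_of_nonneg_complex {f : X → ℂ} (hf : Integrable f μ)
    (h : ∀ᵐ x ∂μ, 0 ≤ f x) : ∫⁻ x, ‖f x‖ₑ ∂μ = ‖∫ x, f x ∂μ‖ₑ := by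
  have hnorm : ∫ x, f x ∂μ = ((∫ x, ‖f x‖ ∂μ : ℝ) : ℂ) := by
    rw [← integral_complex_ofReal]
    exact integral_congr_ae (h.mono fun x hx => Complex.eq_coe_norm_of_nonneg hx)
  rw [hnorm, ← ofReal_integral_norm_eq_lintegral_enorm hf, ← ofReal_norm, Complex.norm_real,
    Real.norm_of_nonneg (by positivity)]

variable {H : Type*} [NormedAddCommGroup H] [InnerProductSpace ℂ H] [CompleteSpace H]
variable {ι : Type*} {b : HilbertBasis ι ℂ H} {ν : POVM X b} {ρ : State b} {D : X → (H →L[ℂ] H)}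
variable {u v : H}

namespace POVM.IsRNDeriv

theorem integrable_inner (hD : ν.IsRNDeriv ρ D) (hu : u ∈ Submodule.span ℂ (Set.range b))
    (hv : v ∈ Submodule.span ℂ (Set.range b)) :
    Integrable (fun x => inner ℂ u (D x v)) (ν.inducedMeasure ρ) := by
  induction hu, hv using Submodule.span_induction₂ with
  | mem_mem u v hu hv =>
    obtain ⟨⟨i, rfl⟩, ⟨j, rfl⟩⟩ := And.intro hu hv
    exact hD.integrable i j
  | zero_left | zero_right => simp
  | add_left _ _ _ _ _ _ h h' => simpa only [inner_add_left] using h.fun_add h'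
  | add_right _ _ _ _ _ _ h h' => simpa only [map_add, inner_add_right] using h.fun_add h'
  | smul_left _ _ _ _ _ h => simpa only [inner_smul_left] using h.const_mul _
  | smul_right _ _ _ _ _ h => simpa only [map_smul, inner_smul_right] using h.const_mul _

theorem setIntegral_inner (hD : ν.IsRNDeriv ρ D) (hu : u ∈ Submodule.span ℂ (Set.range b))
    (hv : v ∈ Submodule.span ℂ (Set.range b)) {E : Set X} (hE : MeasurableSet E) :
    ∫ x in E, inner ℂ u (D x v) ∂ν.inducedMeasure ρ = inner ℂ u (ν.toFun E v) := by
  induction hu, hv using Submodule.span_induction₂ with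
  | mem_mem u v hu hv =>
    obtain ⟨⟨i, rfl⟩, ⟨j, rfl⟩⟩ := And.intro hu hv
    exact hD.setIntegral_eq i j E hE
  | zero_left | zero_right => simp
  | add_left _ _ _ hu hu' hv h h' =>
    simp only [inner_add_left, ← h, ← h']
    exact integral_add (hD.integrable_inner hu hv).integrableOn
      (hD.integrable_inner hu' hv).integrableOn
  | add_right _ _ _ hu hv hv' h h' =>
    simp only [map_add, inner_add_right, ← h, ← h']
    exact integral_add (hD.integrable_inner hu hv).integrableOn
      (hD.integrable_inner hu hv').integrableOn
  | smul_left _ _ _ _ _ h => simp only [inner_smul_left, integral_const_mul, h]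
  | smul_right _ _ _ _ _ h => simp only [map_smul, inner_smul_right, integral_const_mul, h]

theorem ae_inner_nonneg (hD : ν.IsRNDeriv ρ D) (hv : v ∈ Submodule.span ℂ (Set.range b)) :
    ∀ᵐ x ∂ν.inducedMeasure ρ, 0 ≤ inner ℂ v (D x v) := by
  refine ae_nonneg_of_forall_setIntegral_complex_nonneg (hD.integrable_inner hv hv) fun E hE => ?_
  rw [hD.setIntegral_inner hv hv hE]
  exact ((ContinuousLinearMap.nonneg_iff_isPositive _).1 (ν.nonneg E hE)).inner_nonneg_right v

variable [TopologicalSpace.SeparableSpace H]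

theorem ae_nonneg (hD : ν.IsRNDeriv ρ D) : ∀ᵐ x ∂ν.inducedMeasure ρ, 0 ≤ D x := by
  have := UniformSpace.secondCountable_of_separable H
  let S := Submodule.span ℂ (Set.range b)
  have hS : DenseRange (Subtype.val : S → H) :=
    denseRange_subtype_val.2 (Submodule.dense_iff_topologicalClosure_eq_top.2 b.dense_span)
  have hd := hS.comp (TopologicalSpace.denseRange_denseSeq S) continuous_subtype_val
  simp only [nonneg_iff_inner_nonneg_of_denseRange hd]
  exact ae_all_iff.2 fun n => hD.ae_inner_nonneg (TopologicalSpace.denseSeq S n).2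

theorem weaklyMeasurable_sqrt (hD : ν.IsRNDeriv ρ D) :
    WeaklyMeasurable fun x => CFC.sqrt (D x) :=
  ((isQuantumRandomVariable_iff_weaklyMeasurable b).1 hD.isQuantumRandomVariable).sqrt

theorem lintegral_enorm_sqrt_sq (hD : ν.IsRNDeriv ρ D)
    (hv : v ∈ Submodule.span ℂ (Set.range b)) :
    ∫⁻ x, ‖CFC.sqrt (D x) v‖ₑ ^ 2 ∂ν.inducedMeasure ρ = ‖inner ℂ v (ν.toFun Set.univ v)‖ₑ := by
  calc ∫⁻ x, ‖CFC.sqrt (D x) v‖ₑ ^ 2 ∂ν.inducedMeasure ρ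
      = ∫⁻ x, ‖inner ℂ v (D x v)‖ₑ ∂ν.inducedMeasure ρ := by
        refine lintegral_congr_ae ?_
        filter_upwards [hD.ae_nonneg] with x hx
        rw [← inner_sqrt hx, inner_self_eq_norm_sq_to_K, enorm_pow, ← ofReal_norm,
          ← ofReal_norm, RCLike.norm_ofReal, abs_norm]
    _ = ‖∫ x, inner ℂ v (D x v) ∂ν.inducedMeasure ρ‖ₑ :=
        lintegral_enorm_of_nonneg_complex (hD.integrable_inner hv hv) (hD.ae_inner_nonneg hv)
    _ = ‖inner ℂ v (ν.toFun Set.univ v)‖ₑ := by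
        rw [← hD.setIntegral_inner hv hv MeasurableSet.univ, Measure.restrict_univ]

theorem squareIntegrable_sqrt (hD : ν.IsRNDeriv ρ D) :
    SquareIntegrable (ν.inducedMeasure ρ) fun x => CFC.sqrt (D x) := by
  refine .of_dense (S := Submodule.span ℂ (Set.range b)) (C := NNReal.sqrt ‖ν.toFun Set.univ‖₊)
    (fun v => (hD.weaklyMeasurable_sqrt.stronglyMeasurable_apply v).aestronglyMeasurable)
    (Submodule.dense_iff_topologicalClosure_eq_top.2 b.dense_span) fun v hv => ?_
  refine (ENNReal.pow_le_pow_left_iff two_ne_zero).1 ?_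
  calc eLpNorm (fun x => CFC.sqrt (D x) v) 2 (ν.inducedMeasure ρ) ^ 2
      = ‖inner ℂ v (ν.toFun Set.univ v)‖ₑ := by
        rw [← hD.lintegral_enorm_sqrt_sq hv]
        simpa using eLpNorm_nnreal_pow_eq_lintegral (p := 2) two_ne_zero
    _ ≤ ‖v‖ₑ * (‖ν.toFun Set.univ‖ₑ * ‖v‖ₑ) :=
        (ENNReal.coe_le_coe.2 (nnnorm_inner_le_nnnorm v _)).trans
          (mul_right_mono (ContinuousLinearMap.le_opENorm _ v))
    _ = (NNReal.sqrt ‖ν.toFun Set.univ‖₊ * ‖v‖ₑ) ^ 2 := by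
        rw [mul_pow, ← ENNReal.coe_pow, NNReal.sq_sqrt, enorm_eq_nnnorm (ν.toFun _)]
        ring

end POVM.IsRNDeriv

end RadonNikodym

section Expectation

variable {H : Type*} [NormedAddCommGroup H] [InnerProductSpace ℂ H] [CompleteSpace H]
variable {ι : Type*}

theorem star_sqrt (A : H →L[ℂ] H) : star (CFC.sqrt A) = CFC.sqrt A :=
  (IsSelfAdjoint.of_nonneg (CFC.sqrt_nonneg A)).star_eq

theorem eq_of_forall_trace_state_mul_eq (b : HilbertBasis ι ℂ H) {A B : H →L[ℂ] H}
    (h : ∀ s : State b, trace b (s.op * A) = trace b (s.op * B)) : A = B := by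
  refine ContinuousLinearMap.coe_injective ((ext_inner_map _ _).1 fun v => ?_)
  rcases eq_or_ne v 0 with rfl | hv
  · simp
  obtain ⟨s, hs⟩ := exists_state_forall_inner_eq b hv
  have hv' : inner ℂ v (A v) = inner ℂ v (B v) := by rw [hs A, hs B, h s]
  rw [← inner_conj_symm, ← inner_conj_symm _ v]
  exact congrArg _ hv'

theorem scalarDensity_eq_trace_conj {b : HilbertBasis ι ℂ H} {X : Type*} (D F : X → (H →L[ℂ] H))
    (s : State b) (x : X) :
    scalarDensity D F s x =
      trace b (F x * CFC.sqrt (D x) * s.op * star (CFC.sqrt (D x))) := by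
  rw [scalarDensity, mul_assoc, (s.isTraceClass.mul_right _).trace_mul_comm, star_sqrt, mul_assoc]
  simp only [mul_assoc]

variable {X : Type*} [MeasurableSpace X]
variable {b : HilbertBasis ι ℂ H} {ν : POVM X b} {ρ : State b} {D : X → (H →L[ℂ] H)}

theorem POVM.HasQIntegral.expectation_eq {f : ν.EssBounded} {A : H →L[ℂ] H}
    (hA : ν.HasQIntegral ρ D f.1 A) : ν.expectation ρ D (Submodule.Quotient.mk f) = A := by
  have hex : ∃ A, ν.HasQIntegral ρ D f.1 A := ⟨A, hA⟩
  calc ν.expectation ρ D (Submodule.Quotient.mk f) = hex.choose := dif_pos hex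
    _ = A := eq_of_forall_trace_state_mul_eq b fun s => by rw [hex.choose_spec.2, hA.2]

variable [TopologicalSpace.SeparableSpace H]

theorem POVM.weaklyMeasurable_of_essBounded (f : ν.EssBounded) : WeaklyMeasurable f.1 :=
  (isQuantumRandomVariable_iff_weaklyMeasurable b).1 f.2.1

namespace POVM.IsRNDeriv

variable {F : X → (H →L[ℂ] H)} {M : ℝ}

theorem squareIntegrable_mul_sqrt (hD : ν.IsRNDeriv ρ D) (hF : WeaklyMeasurable F)
    (hM : ∀ᵐ x ∂ν.inducedMeasure ρ, ‖F x‖ ≤ M) :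
    SquareIntegrable (ν.inducedMeasure ρ) fun x => F x * CFC.sqrt (D x) :=
  hD.squareIntegrable_sqrt.mul_left hD.weaklyMeasurable_sqrt hF hM

theorem integrablePos (hD : ν.IsRNDeriv ρ D) (hF : WeaklyMeasurable F)
    (hM : ∀ᵐ x ∂ν.inducedMeasure ρ, ‖F x‖ ≤ M) : ν.IntegrablePos ρ D F := fun s => by
  have := countable_of_orthonormal b.orthonormal
  rw [funext (scalarDensity_eq_trace_conj D F s)]
  exact s.isTraceClass.integrable_trace_conj hD.squareIntegrable_sqrt
    (hD.squareIntegrable_mul_sqrt hF hM)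

theorem qIntegrable (hD : ν.IsRNDeriv ρ D) (hF : WeaklyMeasurable F)
    (hM : ∀ᵐ x ∂ν.inducedMeasure ρ, ‖F x‖ ≤ M) : ν.QIntegrable ρ D F := by
  have hre := hM.mono fun x hx => (realPart.norm_le (F x)).trans hx
  have him := hM.mono fun x hx => (imaginaryPart.norm_le (F x)).trans hx
  exact ⟨
    hD.integrablePos (hF.realPart.posPart fun x => (ℜ (F x)).2)
      (hre.mono fun x hx => (CStarAlgebra.norm_posPart_le _).trans hx),
    hD.integrablePos (hF.realPart.negPart fun x => (ℜ (F x)).2)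
      (hre.mono fun x hx => (CStarAlgebra.norm_negPart_le _).trans hx),
    hD.integrablePos (hF.imaginaryPart.posPart fun x => (ℑ (F x)).2)
      (him.mono fun x hx => (CStarAlgebra.norm_posPart_le _).trans hx),
    hD.integrablePos (hF.imaginaryPart.negPart fun x => (ℑ (F x)).2)
      (him.mono fun x hx => (CStarAlgebra.norm_negPart_le _).trans hx)⟩

theorem hasQIntegral_integralAdjointComp (hD : ν.IsRNDeriv ρ D) (hF : WeaklyMeasurable F)
    (hM : ∀ᵐ x ∂ν.inducedMeasure ρ, ‖F x‖ ≤ M) :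
    ν.HasQIntegral ρ D F
      (hD.squareIntegrable_sqrt.integralAdjointComp (hD.squareIntegrable_mul_sqrt hF hM)) := by
  have := countable_of_orthonormal b.orthonormal
  refine ⟨hD.qIntegrable hF hM, fun s => ?_⟩
  simp only [scalarDensity_eq_trace_conj]
  exact s.isTraceClass.trace_mul_integralAdjointComp _ _

theorem hasQIntegral_iff (hD : ν.IsRNDeriv ρ D) (f : ν.EssBounded) (A : H →L[ℂ] H) :
    ν.HasQIntegral ρ D f.1 A ↔ A = ν.expectation ρ D (Submodule.Quotient.mk f) := by
  obtain ⟨M, hM⟩ := f.2.2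
  have h := hD.hasQIntegral_integralAdjointComp (weaklyMeasurable_of_essBounded f)
    (hM.filter_mono (ν.ae_inducedMeasure_le ρ))
  refine ⟨fun hA => hA.expectation_eq.symm, ?_⟩
  rintro rfl
  rwa [h.expectation_eq]

theorem memPredual_sqrt_conj (hD : ν.IsRNDeriv ρ D) {T : H →L[ℂ] H} (hT : IsTraceClass b T) :
    ν.MemPredual ρ fun x => CFC.sqrt (D x) * T * CFC.sqrt (D x) := by
  have := countable_of_orthonormal b.orthonormal
  have hR := hD.weaklyMeasurable_sqrt
  refine ⟨(isQuantumRandomVariable_iff_weaklyMeasurable b).2 ((hR.mul (.const T)).mul hR), ?_⟩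
  simpa only [star_sqrt] using
    hT.lintegral_traceNorm_conj_lt_top hD.squareIntegrable_sqrt hD.squareIntegrable_sqrt

theorem trace_mul_expectation (hD : ν.IsRNDeriv ρ D) {T : H →L[ℂ] H} (hT : IsTraceClass b T)
    (q : ν.Linfty) : trace b (T * ν.expectation ρ D q) =
      ν.pairing ρ (fun x => CFC.sqrt (D x) * T * CFC.sqrt (D x)) q := by
  have := countable_of_orthonormal b.orthonormal
  obtain ⟨f, rfl⟩ := Submodule.Quotient.mk_surjective _ q
  obtain ⟨M, hM⟩ := f.2.2
  have h := hD.hasQIntegral_integralAdjointComp (weaklyMeasurable_of_essBounded f)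
    (hM.filter_mono (ν.ae_inducedMeasure_le ρ))
  rw [h.expectation_eq, hT.trace_mul_integralAdjointComp]
  refine integral_congr_ae (ae_of_all _ fun x => ?_)
  simp only [((hT.mul_left _).mul_right _).trace_mul_comm (f.1 x), star_sqrt]
  simp only [mul_assoc]

theorem continuous_expectation (hD : ν.IsRNDeriv ρ D) :
    Continuous[ν.weakStar ρ, ultraweak b] (ν.expectation ρ D) := by
  refine continuous_iInf_rng.2 fun T => continuous_induced_rng.2 ?_
  rw [show (fun A => trace b (T.1 * A)) ∘ ν.expectation ρ D = _ from
    funext fun q => hD.trace_mul_expectation T.2 q]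
  exact continuous_iInf_dom (i := ⟨_, hD.memPredual_sqrt_conj T.2⟩) continuous_induced_dom

end POVM.IsRNDeriv

end Expectation

end QuantumExpectation

theorem theorem2p6_general
    {H : Type*} [NormedAddCommGroup H] [InnerProductSpace ℂ H] [CompleteSpace H]
    [TopologicalSpace.SeparableSpace H]
    {ι : Type*} (b : HilbertBasis ι ℂ H)
    {X : Type*} [MeasurableSpace X]
    (ν : POVM X b)
    (ρ : State b)
    (D : X → (H →L[ℂ] H)) (hD : ν.IsRNDeriv ρ D) :
    (∀ (f : ν.EssBounded) (A : H →L[ℂ] H),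
      ν.HasQIntegral ρ D f.1 A ↔ A = ν.expectation ρ D (Submodule.Quotient.mk f)) ∧
    (∀ s : H →L[ℂ] H, IsTraceClass b s →
      ν.MemPredual ρ (fun x => CFC.sqrt (D x) * s * CFC.sqrt (D x))) ∧
    Continuous[ν.weakStar ρ, ultraweak b] (ν.expectation ρ D) :=
  ⟨hD.hasQIntegral_iff, fun _ hs => hD.memPredual_sqrt_conj hs, hD.continuous_expectation⟩

theorem theorem2p6
    {H : Type*} [NormedAddCommGroup H] [InnerProductSpace ℂ H] [CompleteSpace H]
    [TopologicalSpace.SeparableSpace H]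
    {ι : Type*} (b : HilbertBasis ι ℂ H)
    {X : Type*} [MeasurableSpace X]
    (ν : POVM X b)
    (ρ : State b) (hρ : ρ.FullRank)
    (D : X → (H →L[ℂ] H)) (hD : ν.IsRNDeriv ρ D) :
    (∀ (f : ν.EssBounded) (A : H →L[ℂ] H),
      ν.HasQIntegral ρ D f.1 A ↔ A = ν.expectation ρ D (Submodule.Quotient.mk f)) ∧
    (∀ s : H →L[ℂ] H, IsTraceClass b s →
      ν.MemPredual ρ (fun x => CFC.sqrt (D x) * s * CFC.sqrt (D x))) ∧
    Continuous[ν.weakStar ρ, ultraweak b] (ν.expectation ρ D) :=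
  theorem2p6_general b ν ρ D hD
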